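/- Setting. Let $n\ge 1$, let $X$ be a locally compact Hausdorff space, let $\mathcal E$ be a locally trivial bundle over $X$ with fibre $\mathbb M_n=M_n(\mathbb C)$ and structure group $\mathrm{Aut}(\mathbb M_n)=PU(n)$, and let $A=\Gamma_0(\mathcal E)$ be the $n$-homogeneous $C^*$-algebra of continuous sections of $\mathcal E$ vanishing at infinity (so that $\mathrm{Prim}(A)=X$). Let $M(A)$ be the multiplier algebra of $A$ and let $$\mathrm{TM}(A)=\{M_{a,b}: a,b\in M(A)\},\qquad M_{a,b}:A\to A,\ x\mapsto axb,$$ be the set of two-sided multiplications; let $\overline{\overline{\mathrm{TM}(A)}}$ be its closure in operator norm in the space $\mathcal B(A)$ of bounded linear operators on $A$. Let $\mathrm{IB}(A)$ be the set of all $\phi\in\mathcal B(A)$ with $\phi(I)\subseteq I$ for every closed two-sided ideal $I$ of $A$; it contains $\overline{\overline{\mathrm{TM}(A)}}$. For $\phi\in\mathrm{IB}(A)$ and $t\in X$ let $\phi_t$ be the operator induced by $\phi$ on $A_t=A/\{a\in A: a(t)=0\}=\mathcal E_t\cong\mathbb M_n$, that is, $\phi_t(a(t))=\phi(a)(t)$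 for $a\in A$. Finally, let $$\mathrm{IB}_1^{\mathrm{nv}}(A)=\{\phi\in\mathrm{IB}(A): 0\neq\phi_t\in\mathrm{TM}(A_t)\text{ for all }t\in X\}.$$ Statement. 1. If $\phi\in\overline{\overline{\mathrm{TM}(A)}}$ and $\inf_{t\in X}\|\phi_t\|=\delta>0$, then $\phi\in\mathrm{TM}(A)$. 2. In particular, if $A$ is unital, then $\overline{\overline{\mathrm{TM}(A)}}\cap\mathrm{IB}_1^{\mathrm{nv}}(A)\subseteq\mathrm{TM}(A)$. -/

import Mathlib

noncomputable section

open Bundle Topology Filter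
open scoped ENNReal

namespace HomogCStar

universe u v

/-! ## Operators on a general C*-algebra -/

section General

variable {A : Type*} [NonUnitalCStarAlgebra A]

/-- Closed two-sided ideals of a C*-algebra. -/
structure IsClosedIdeal (I : Submodule ℂ A) : Prop where
  isClosed : IsClosed (I : Set A)
  mul_mem_left : ∀ (a : A) {x : A}, x ∈ I → a * x ∈ I
  mul_mem_right : ∀ (a : A) {x : A}, x ∈ I → x * a ∈ I

variable (A) in
/-- `IB A`: the bounded linear maps `A → A` that preserve every closed two-sided ideal of `A`. -/
def IB : Set (A →L[ℂ] A) :=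
  {φ | ∀ I : Submodule ℂ A, IsClosedIdeal I → ∀ x ∈ I, φ x ∈ I}

/-- The two-sided multiplication `M_{a,b} : x ↦ a x b` with `a`, `b` in the multiplier algebra of
`A`. A multiplier `a` is a double centralizer: `a.fst` is `x ↦ a x` and `a.snd` is `x ↦ x a`. -/
def twoSidedMul (a b : DoubleCentralizer ℂ A) : A →L[ℂ] A :=
  a.fst.comp b.snd

variable (A) in
/-- `TM A`: the set of all two-sided multiplications on `A`, with coefficients in the multiplier
algebra of `A`. -/
def TM : Set (A →L[ℂ] A) :=
  {φ | ∃ a b : DoubleCentralizer ℂ A, φ = twoSidedMul a b}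

/-- A double centralizer maps closed ideals to themselves, on both sides. -/
theorem multiplier_mem {I : Submodule ℂ A} (hI : IsClosedIdeal I) (a : DoubleCentralizer ℂ A)
    {x : A} (hx : x ∈ I) : a.fst x ∈ I ∧ a.snd x ∈ I := by
  let _ : PartialOrder A := CStarAlgebra.spectralOrder A
  have _ : StarOrderedRing A := CStarAlgebra.spectralOrderedRing A
  have hu := CStarAlgebra.increasingApproximateUnit A
  have hne := hu.neBot
  constructor
  · refine hI.isClosed.mem_of_tendsto (hu.tendsto_mul_right (a.fst x)) (Eventually.of_forall ?_)
    intro y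
    have : y * a.fst x = a.snd y * x := (a.central y x).symm
    rw [this]
    exact hI.mul_mem_left _ hx
  · refine hI.isClosed.mem_of_tendsto (hu.tendsto_mul_left (a.snd x)) (Eventually.of_forall ?_)
    intro y
    have : a.snd x * y = x * a.fst y := a.central x y
    rw [this]
    exact hI.mul_mem_right _ hx

theorem closure_TM_subset_IB : closure (TM A) ⊆ IB A := by
  intro φ hφ I hI x hx
  have hcl : IsClosed {ψ : A →L[ℂ] A | ψ x ∈ I} :=
    hI.isClosed.preimage (ContinuousLinearMap.apply ℂ A x).continuous
  refine closure_minimal ?_ hcl hφ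
  rintro _ ⟨a, b, rfl⟩
  exact (multiplier_mem hI a (multiplier_mem hI b hx).2).1

end General

/-! ## Bundles of matrix algebras and their section algebras -/

/-- A locally trivial bundle `E` over `X` with fibre `M_n` and structure group
`Aut(M_n) = PU(n)`: a topological fibre bundle whose fibres are C*-algebras and whose local
trivializations restrict to *-isomorphisms `E t ≃ M_n` of the fibres. (Continuity of the transition
maps `U ∩ V → Aut(M_n)` is automatic, since `M_n` is finite-dimensional.) -/
class MatrixBundle (n : ℕ) {X : Type u} [TopologicalSpace X] (E : X → Type v)
    [∀ t, CStarAlgebra (E t)] [TopologicalSpace (TotalSpace (Matrix (Fin n) (Fin n) ℂ) E)]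
    [FiberBundle (Matrix (Fin n) (Fin n) ℂ) E] : Prop where
  exists_starAlgEquiv : ∀ e ∈ FiberBundle.trivializationAtlas (Matrix (Fin n) (Fin n) ℂ) E,
    ∀ t ∈ e.baseSet, ∃ Φ : E t ≃⋆ₐ[ℂ] Matrix (Fin n) (Fin n) ℂ,
      ∀ x : E t, (e (TotalSpace.mk t x)).2 = Φ x

open scoped Matrix.Norms.L2Operator in
theorem norm_starAlgEquiv {n : ℕ} {B : Type*} [CStarAlgebra B]
    (Φ : B ≃⋆ₐ[ℂ] Matrix (Fin n) (Fin n) ℂ) (x : B) : ‖Φ x‖ = ‖x‖ :=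
  NonUnitalStarAlgHom.norm_map Φ Φ.injective x

section Sections

variable (n : ℕ) {X : Type u} [TopologicalSpace X] (E : X → Type v)
    [∀ t, CStarAlgebra (E t)] [TopologicalSpace (TotalSpace (Matrix (Fin n) (Fin n) ℂ) E)]
    [FiberBundle (Matrix (Fin n) (Fin n) ℂ) E]

variable {E} in
/-- Continuity of a (set-theoretic) section of the bundle. -/
def ContinuousSection (s : ∀ t, E t) : Prop :=
  Continuous fun t => TotalSpace.mk' (Matrix (Fin n) (Fin n) ℂ) t (s t)

/-- The chart at `t₀`, as a family of maps on the fibres. -/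
def chart (t₀ t : X) (x : E t) : Matrix (Fin n) (Fin n) ℂ :=
  (trivializationAt (Matrix (Fin n) (Fin n) ℂ) E t₀ (TotalSpace.mk t x)).2

variable {E} in
theorem continuousSection_iff (s : ∀ t, E t) :
    ContinuousSection n s ↔ ∀ t₀, ContinuousAt (fun t => chart n E t₀ t (s t)) t₀ := by
  rw [ContinuousSection, continuous_iff_continuousAt]
  refine forall_congr' fun t₀ => ?_
  rw [FiberBundle.continuousAt_totalSpace]
  exact and_iff_right continuousAt_id

variable [MatrixBundle n E]

theorem exists_chart_eq {t₀ t : X}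
    (ht : t ∈ (trivializationAt (Matrix (Fin n) (Fin n) ℂ) E t₀).baseSet) :
    ∃ Φ : E t ≃⋆ₐ[ℂ] Matrix (Fin n) (Fin n) ℂ, ∀ x : E t, chart n E t₀ t x = Φ x :=
  MatrixBundle.exists_starAlgEquiv _ (FiberBundle.trivialization_mem_atlas _ E t₀) t ht

theorem eventually_exists_chart_eq (t₀ : X) : ∀ᶠ t in 𝓝 t₀,
    ∃ Φ : E t ≃⋆ₐ[ℂ] Matrix (Fin n) (Fin n) ℂ, ∀ x : E t, chart n E t₀ t x = Φ x := by
  filter_upwards [(trivializationAt (Matrix (Fin n) (Fin n) ℂ) E t₀).open_baseSet.mem_nhds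
    (FiberBundle.mem_baseSet_trivializationAt' t₀)] with t ht
  exact exists_chart_eq n E ht

variable {E}

theorem ContinuousSection.add {s s' : ∀ t, E t} (h : ContinuousSection n s)
    (h' : ContinuousSection n s') : ContinuousSection n (s + s') := by
  rw [continuousSection_iff] at *
  intro t₀
  refine ((h t₀).add (h' t₀)).congr ?_
  filter_upwards [eventually_exists_chart_eq n E t₀] with t ⟨Φ, hΦ⟩
  simp [hΦ]

theorem ContinuousSection.mul {s s' : ∀ t, E t} (h : ContinuousSection n s)
    (h' : ContinuousSection n s') : ContinuousSection n (s * s') := by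
  rw [continuousSection_iff] at *
  intro t₀
  refine ((h t₀).mul (h' t₀)).congr ?_
  filter_upwards [eventually_exists_chart_eq n E t₀] with t ⟨Φ, hΦ⟩
  simp [hΦ]

theorem ContinuousSection.smul {f : X → ℂ} (hf : Continuous f) {s : ∀ t, E t}
    (h : ContinuousSection n s) : ContinuousSection n (fun t => f t • s t) := by
  rw [continuousSection_iff] at *
  intro t₀
  refine (hf.continuousAt.smul (h t₀)).congr ?_
  filter_upwards [eventually_exists_chart_eq n E t₀] with t ⟨Φ, hΦ⟩
  simp [hΦ]

theorem ContinuousSection.star_section {s : ∀ t, E t} (h : ContinuousSection n s) :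
    ContinuousSection n (star s) := by
  rw [continuousSection_iff] at *
  intro t₀
  refine (h t₀).star.congr ?_
  filter_upwards [eventually_exists_chart_eq n E t₀] with t ⟨Φ, hΦ⟩
  simp [hΦ, map_star]

theorem ContinuousSection.zero : ContinuousSection n (0 : ∀ t, E t) := by
  rw [continuousSection_iff]
  intro t₀
  refine (continuousAt_const (y := (0 : Matrix (Fin n) (Fin n) ℂ))).congr ?_
  filter_upwards [eventually_exists_chart_eq n E t₀] with t ⟨Φ, hΦ⟩
  simp [hΦ]

variable (E)

/-- The continuous sections of `E` vanishing at infinity, as a *-subalgebra of the C*-algebra of all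
bounded sections (with the supremum norm and pointwise operations). -/
def sectionSubalgebra : NonUnitalStarSubalgebra ℂ (lp E ∞) where
  carrier := {s | ContinuousSection n (s : ∀ t, E t) ∧
    Tendsto (fun t => ‖(s : ∀ t, E t) t‖) (cocompact X) (𝓝 0)}
  add_mem' := by
    rintro s s' ⟨h, h0⟩ ⟨h', h0'⟩
    refine ⟨h.add n h', ?_⟩
    have := h0.add h0'
    rw [add_zero] at this
    exact squeeze_zero (fun _ => norm_nonneg _) (fun t => norm_add_le _ _) this
  zero_mem' := by
    refine ⟨ContinuousSection.zero n, ?_⟩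
    simpa using tendsto_const_nhds
  mul_mem' := by
    rintro s s' ⟨h, h0⟩ ⟨h', h0'⟩
    refine ⟨h.mul n h', ?_⟩
    have := h0.mul h0'
    rw [mul_zero] at this
    exact squeeze_zero (fun _ => norm_nonneg _) (fun t => norm_mul_le _ _) this
  smul_mem' := by
    rintro c s ⟨h, h0⟩
    refine ⟨ContinuousSection.smul n continuous_const h, ?_⟩
    have := h0.const_mul ‖c‖
    rw [mul_zero] at this
    exact squeeze_zero (fun _ => norm_nonneg _) (fun t => norm_smul_le _ _) this
  star_mem' := by
    rintro s ⟨h, h0⟩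
    refine ⟨h.star_section n, ?_⟩
    simpa using h0


open scoped Matrix.Norms.L2Operator in
instance isClosed_sectionSubalgebra : IsClosed (sectionSubalgebra n E : Set (lp E ∞)) := by
  refine isClosed_of_closure_subset fun s hs => ?_
  have happ : ∀ ε > 0, ∃ s' ∈ sectionSubalgebra n E, ∀ t, ‖s t - s' t‖ < ε := by
    intro ε hε
    obtain ⟨s', hs', hd⟩ := Metric.mem_closure_iff.1 hs ε hε
    refine ⟨s', hs', fun t => ?_⟩
    rw [dist_eq_norm] at hd
    exact (lp.norm_apply_le_norm ENNReal.top_ne_zero (s - s') t).trans_lt hd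
  constructor
  · rw [continuousSection_iff]
    intro t₀
    refine continuousAt_of_locally_uniform_approx_of_continuousAt fun u hu => ?_
    obtain ⟨ε, hε, hεu⟩ := Metric.mem_uniformity_dist.1 hu
    obtain ⟨s', hs', hd⟩ := happ ε hε
    refine ⟨_, eventually_exists_chart_eq n E t₀, fun t => chart n E t₀ t (s' t),
      (continuousSection_iff n _).1 hs'.1 t₀, ?_⟩
    rintro t ⟨Φ, hΦ⟩
    apply hεu
    change dist (chart n E t₀ t (s t)) (chart n E t₀ t (s' t)) < ε
    have h1 : dist (Φ (s t)) (Φ (s' t)) < ε := by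
      rw [dist_eq_norm, ← map_sub, norm_starAlgEquiv]
      exact hd t
    rwa [← hΦ, ← hΦ] at h1
  · rw [Metric.tendsto_nhds]
    intro ε hε
    obtain ⟨s', hs', hd⟩ := happ (ε / 2) (half_pos hε)
    filter_upwards [Metric.tendsto_nhds.1 hs'.2 (ε / 2) (half_pos hε)] with t ht
    rw [Real.dist_0_eq_abs, abs_norm] at ht ⊢
    have h1 := norm_add_le (s t - s' t) (s' t)
    rw [sub_add_cancel] at h1
    linarith [hd t]

/-- The C*-algebra `Γ₀(E)` of continuous sections of `E` vanishing at infinity. -/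
abbrev Gamma0 : Type (max u v) := sectionSubalgebra n E

/-- `Γ₀(E)` is a C*-algebra for the pointwise operations and the supremum norm. -/
instance : NonUnitalCStarAlgebra (Gamma0 n E) :=
  NonUnitalStarSubalgebra.nonUnitalCStarAlgebra (sectionSubalgebra n E)

variable {n E}

/-- The value `a(t) ∈ E t` of a section. -/
def Gamma0.val (a : Gamma0 n E) (t : X) : E t := (a : lp E ∞) t

theorem Gamma0.norm_val_le (a : Gamma0 n E) (t : X) : ‖a.val t‖ ≤ ‖a‖ :=
  lp.norm_apply_le_norm ENNReal.top_ne_zero (a : lp E ∞) t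

variable (n E)

/-- The closed ideal `I_t = {a : a(t) = 0}` of `Γ₀(E)`. -/
def idealAt (t : X) : Submodule ℂ (Gamma0 n E) where
  carrier := {a | a.val t = 0}
  add_mem' {a b} ha hb := by
    change a.val t + b.val t = 0
    rw [show a.val t = 0 from ha, show b.val t = 0 from hb, add_zero]
  zero_mem' := rfl
  smul_mem' c a ha := by
    change c • a.val t = 0
    rw [show a.val t = 0 from ha, smul_zero]

theorem isClosedIdeal_idealAt (t : X) : IsClosedIdeal (idealAt n E t) where
  isClosed := by
    refine isClosed_of_closure_subset fun a ha => ?_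
    change a.val t = 0
    rw [← norm_le_zero_iff]
    refine le_of_forall_pos_le_add fun ε hε => ?_
    obtain ⟨b, hb, hd⟩ := Metric.mem_closure_iff.1 ha ε hε
    have h1 : (a - b).val t = a.val t := by
      change a.val t - b.val t = _
      rw [show b.val t = 0 from hb, sub_zero]
    rw [← h1, zero_add]
    rw [dist_eq_norm] at hd
    exact ((a - b).norm_val_le t).trans hd.le
  mul_mem_left a x hx := by
    change a.val t * x.val t = 0
    rw [show x.val t = 0 from hx, mul_zero]
  mul_mem_right a x hx := by
    change x.val t * a.val t = 0
    rw [show x.val t = 0 from hx, zero_mul]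

open scoped Matrix.Norms.L2Operator in
/-- Every vector of a fibre is the value of a section of no larger norm; so evaluation at `t`
identifies the quotient C*-algebra `Γ₀(E) / I_t` with the fibre `E t`. -/
theorem exists_section [T2Space X] [LocallyCompactSpace X] (t₀ : X) (v : E t₀) :
    ∃ a : Gamma0 n E, a.val t₀ = v ∧ ‖a‖ ≤ ‖v‖ := by
  set e := trivializationAt (Matrix (Fin n) (Fin n) ℂ) E t₀ with he
  have ht₀ : t₀ ∈ e.baseSet := FiberBundle.mem_baseSet_trivializationAt' t₀
  obtain ⟨K, hK, hKt, hKe⟩ := exists_compact_subset e.open_baseSet ht₀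
  obtain ⟨f, hf1, hf0, -, hf01⟩ := exists_continuous_one_zero_of_isCompact
    (isCompact_singleton (x := t₀)) (isOpen_interior (s := K)).isClosed_compl
    (by simpa using hKt)
  have hf0' : ∀ t ∉ K, f t = 0 := fun t ht => hf0 fun h => ht (interior_subset h)
  set s : ∀ t, E t := fun t => (f t : ℂ) • e.symm t (chart n E t₀ t₀ v) with hs
  have hs0 : ∀ t ∉ K, s t = 0 := fun t ht => by simp [hs, hf0' t ht]
  have hst : s t₀ = v := by
    have h1 : f t₀ = 1 := hf1 rfl
    have h2 : e.symm t₀ (chart n E t₀ t₀ v) = v := e.symm_apply_apply_mk ht₀ v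
    simp [hs, h1, h2]
  have hnorm : ∀ t, ‖s t‖ ≤ ‖v‖ := by
    intro t
    by_cases ht : t ∈ K
    · obtain ⟨Φ, hΦ⟩ := exists_chart_eq n E (hKe ht)
      obtain ⟨Ψ, hΨ⟩ := exists_chart_eq n E ht₀
      have h1 : ∀ c, chart n E t₀ t (e.symm t c) = c := fun c =>
        congrArg Prod.snd (e.apply_mk_symm (hKe ht) c)
      have h2 : ‖e.symm t (chart n E t₀ t₀ v)‖ = ‖v‖ := by
        rw [← norm_starAlgEquiv Φ, ← hΦ, h1, hΨ, norm_starAlgEquiv]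
      rw [hs, norm_smul, h2, Complex.norm_real, Real.norm_eq_abs, abs_of_nonneg (hf01 t).1]
      exact mul_le_of_le_one_left (norm_nonneg _) (hf01 t).2
    · rw [hs0 t ht, norm_zero]
      exact norm_nonneg _
  have hcont : ContinuousSection n s := by
    rw [continuousSection_iff]
    intro t₁
    by_cases ht : t₁ ∈ K
    · have h1 : ContinuousAt (fun t => TotalSpace.mk' (Matrix (Fin n) (Fin n) ℂ) t
          (e.symm t (chart n E t₀ t₀ v))) t₁ := by
        have h2 := e.continuousOn_symm.continuousAt (x := (t₁, chart n E t₀ t₀ v))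
          ((e.open_baseSet.prod isOpen_univ).mem_nhds ⟨hKe ht, trivial⟩)
        exact h2.comp (f := fun t => (t, chart n E t₀ t₀ v))
          (continuousAt_id.prodMk continuousAt_const)
      have h3 := ((FiberBundle.continuousAt_totalSpace _ _).1 h1).2
      have h4 : ContinuousAt (fun t => (f t : ℂ)) t₁ :=
        (Complex.continuous_ofReal.comp f.continuous).continuousAt
      refine (h4.smul h3).congr ?_
      filter_upwards [eventually_exists_chart_eq n E t₁] with t ⟨Φ, hΦ⟩
      rw [hΦ, hs, map_smul, ← hΦ]
      rfl
    · have h1 := (continuousSection_iff n _).1 (ContinuousSection.zero (E := E) n) t₁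
      refine h1.congr ?_
      filter_upwards [hK.isClosed.isOpen_compl.mem_nhds ht] with t ht'
      rw [hs0 t ht']
      rfl
  have hmem : Memℓp s ∞ := memℓp_infty ⟨‖v‖, by rintro _ ⟨t, rfl⟩; exact hnorm t⟩
  refine ⟨⟨⟨s, hmem⟩, hcont, ?_⟩, hst, lp.norm_le_of_forall_le (norm_nonneg _) hnorm⟩
  refine tendsto_const_nhds.congr' ?_
  filter_upwards [hK.compl_mem_cocompact] with t ht
  exact (norm_eq_zero.2 (hs0 t ht)).symm

/-! ## The operators induced on the fibres -/

variable {n E} in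
theorem IB_val_congr {φ : Gamma0 n E →L[ℂ] Gamma0 n E} (hφ : φ ∈ IB (Gamma0 n E)) {t : X}
    {a b : Gamma0 n E} (h : a.val t = b.val t) : (φ a).val t = (φ b).val t := by
  have h1 : a - b ∈ idealAt n E t := by
    change a.val t - b.val t = 0
    rw [h, sub_self]
  have h2 := hφ _ (isClosedIdeal_idealAt n E t) _ h1
  rw [map_sub] at h2
  exact sub_eq_zero.1 h2

variable [T2Space X] [LocallyCompactSpace X]

variable {n E} in
/-- For `φ ∈ IB(Γ₀(E))`, the operator `φ_t` induced by `φ` on `Γ₀(E) / I_t = E t`: it sends `a(t)`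
to `φ(a)(t)` (see `fibreOp_val`). -/
def fibreOp (φ : Gamma0 n E →L[ℂ] Gamma0 n E) (hφ : φ ∈ IB (Gamma0 n E)) (t : X) :
    E t →L[ℂ] E t :=
  LinearMap.mkContinuous
    { toFun := fun v => (φ (exists_section n E t v).choose).val t
      map_add' := fun v w => by
        have hv := (exists_section n E t v).choose_spec.1
        have hw := (exists_section n E t w).choose_spec.1
        have hvw := (exists_section n E t (v + w)).choose_spec.1
        generalize (exists_section n E t v).choose = a at *
        generalize (exists_section n E t w).choose = b at *
        generalize (exists_section n E t (v + w)).choose = c at *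
        have h : c.val t = (a + b).val t := by
          rw [hvw, ← hv, ← hw]
          rfl
        rw [IB_val_congr hφ h, map_add]
        rfl
      map_smul' := fun r v => by
        have hv := (exists_section n E t v).choose_spec.1
        have hrv := (exists_section n E t (r • v)).choose_spec.1
        generalize (exists_section n E t v).choose = a at *
        generalize (exists_section n E t (r • v)).choose = c at *
        have h : c.val t = (r • a).val t := by
          rw [hrv, ← hv]
          rfl
        rw [IB_val_congr hφ h, map_smul]
        rfl }
    ‖φ‖ fun v =>
      ((φ (exists_section n E t v).choose).norm_val_le t).trans
        (φ.le_opNorm_of_le (exists_section n E t v).choose_spec.2)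

variable {n E} in
theorem fibreOp_val {φ : Gamma0 n E →L[ℂ] Gamma0 n E} (hφ : φ ∈ IB (Gamma0 n E)) (t : X)
    (a : Gamma0 n E) : fibreOp φ hφ t (a.val t) = (φ a).val t :=
  IB_val_congr hφ (exists_section n E t (a.val t)).choose_spec.1

/-- `IB₁ⁿᵛ(Γ₀(E))`: the `φ ∈ IB(Γ₀(E))` such that every `φ_t` is a nonzero two-sided multiplication
on the fibre `E t`. -/
def IB1nv : Set (Gamma0 n E →L[ℂ] Gamma0 n E) :=
  {φ | ∃ hφ : φ ∈ IB (Gamma0 n E), ∀ t, fibreOp φ hφ t ≠ 0 ∧ fibreOp φ hφ t ∈ TM (E t)}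

end Sections

end HomogCStar

end

noncomputable section

open Bundle Topology Filter
open scoped ENNReal

namespace HomogCStar

universe u v

/-! ## Matrix units and contractions of operators on a matrix algebra -/

section MatrixAlgebra

open Matrix

/-! The coefficients of a two-sided multiplication on a matrix algebra can be recovered from the
operator up to scalars. If `f x = a x b` and `e_ij` are matrix units, then `l = ∑ f(e_ij) y e_ji`
equals `tr(b y) a`, and `r = ∑ e_ij z f(e_ji)` equals `tr(z a) b`. Hence `l x r = tr(l z) f(x)`. The
coefficients no longer appear in this identity and both sides are continuous in `f`, so it passes to
norm limits (`leftContraction_mul_rightContraction`).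

The danger in the bundle setting is that the fibrewise coefficients may not fit together globally,
or that the scalar `tr(l z)` vanishes somewhere. Both are settled by one approximant `M_{c,d}` of
`φ`, with `y = d*` and `z = c*`. These are global bounded sections, and `tr(l z)` is then the
Hilbert-Schmidt inner product of `φ_t` with `(M_{c,d})_t`, which is close to the squared
Hilbert-Schmidt norm of `φ_t`. A uniform lower bound on `‖φ_t‖` keeps it away from zero
(`re_fibreTrace_ge_of_close`). So `l / tr(l z)` and `r` are bounded continuous sections, hence
multipliers, and they implement `φ` (`mem_TM_of_sections`).

If the algebra is unital, `X` is compact. As `‖φ_t‖` is locally bounded below wherever it is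
nonzero, it then has a uniform lower bound. -/

theorem sum_single_mul_mul_single {n : ℕ} (z : Matrix (Fin n) (Fin n) ℂ) :
    ∑ i, ∑ j, Matrix.single i j (1 : ℂ) * z * Matrix.single j i 1 = z.trace • 1 := by
  have h : ∀ i j : Fin n, Matrix.single i j (1 : ℂ) * z * Matrix.single j i 1 =
      z j j • Matrix.single i i 1 := by
    intro i j
    rw [Matrix.single_mul_mul_single, Matrix.smul_single]
    simp
  simp_rw [h, ← Finset.sum_smul, ← Finset.smul_sum]
  congr 1
  rw [← Matrix.diagonal_one, ← Matrix.sum_single_eq_diagonal]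

/-! ### Comparison of the operator norm, the entries and the trace on matrices. -/

section Norms

open scoped Matrix.Norms.L2Operator

variable {n : ℕ}

/-- The C*-identity reduces the claim to `e_ij* e_ij = e_jj`, a diagonal projection. -/
theorem norm_single_one_le (i j : Fin n) : ‖Matrix.single i j (1 : ℂ)‖ ≤ 1 := by
  have h1 : ‖Matrix.single j j (1 : ℂ)‖ ≤ 1 := by
    rw [← Matrix.diagonal_single, Matrix.l2_opNorm_diagonal,
      pi_norm_le_iff_of_nonneg zero_le_one]
    intro k
    by_cases h : k = j
    · subst h; simp
    · simp [Pi.single_eq_of_ne h]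
  have h2 := Matrix.l2_opNorm_conjTranspose_mul_self (Matrix.single i j (1 : ℂ))
  rw [Matrix.conjTranspose_single, star_one, Matrix.single_mul_single_same, mul_one] at h2
  nlinarith [norm_nonneg (Matrix.single i j (1 : ℂ))]

theorem norm_entry_le (m : Matrix (Fin n) (Fin n) ℂ) (i j : Fin n) : ‖m i j‖ ≤ ‖m‖ := by
  have h1 := Matrix.l2_opNorm_mulVec m (EuclideanSpace.single j 1)
  rw [PiLp.norm_single, norm_one, mul_one] at h1
  refine le_trans ?_ h1
  have h2 := PiLp.norm_apply_le ((EuclideanSpace.equiv (Fin n) ℂ).symm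
    (m *ᵥ (EuclideanSpace.single j (1 : ℂ)).ofLp)) i
  refine le_trans (le_of_eq ?_) h2
  simp

theorem norm_trace_le (m : Matrix (Fin n) (Fin n) ℂ) : ‖m.trace‖ ≤ n * ‖m‖ := by
  refine (norm_sum_le _ _).trans ?_
  refine (Finset.sum_le_sum fun i _ => norm_entry_le m i i).trans (le_of_eq ?_)
  simp

theorem trace_mul_conjTranspose_re (m : Matrix (Fin n) (Fin n) ℂ) :
    (m * mᴴ).trace.re = ∑ i, ∑ j, ‖m i j‖ ^ 2 := by
  simp only [Matrix.trace, Matrix.diag, Matrix.mul_apply, Matrix.conjTranspose_apply,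
    Complex.re_sum]
  refine Finset.sum_congr rfl fun i _ => Finset.sum_congr rfl fun j _ => ?_
  rw [← starRingEnd_apply, Complex.mul_conj, Complex.ofReal_re, Complex.normSq_eq_norm_sq]

theorem norm_le_sum_norm_entry (m : Matrix (Fin n) (Fin n) ℂ) :
    ‖m‖ ≤ ∑ i, ∑ j, ‖m i j‖ := by
  conv_lhs => rw [Matrix.matrix_eq_sum_single m]
  refine (norm_sum_le _ _).trans (Finset.sum_le_sum fun i _ => ?_)
  refine (norm_sum_le _ _).trans (Finset.sum_le_sum fun j _ => ?_)
  have : Matrix.single i j (m i j) = m i j • Matrix.single i j (1 : ℂ) := by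
    rw [Matrix.smul_single, smul_eq_mul, mul_one]
  rw [this, norm_smul]
  exact mul_le_of_le_one_right (norm_nonneg _) (norm_single_one_le i j)

theorem sq_sum_sum_le (g : Fin n → Fin n → ℝ) :
    (∑ i, ∑ j, g i j) ^ 2 ≤ (n : ℝ) ^ 2 * ∑ i, ∑ j, g i j ^ 2 := by
  have h := sq_sum_le_card_mul_sum_sq (s := (Finset.univ : Finset (Fin n × Fin n)))
    (f := fun p => g p.1 p.2)
  rw [Fintype.sum_prod_type, Fintype.sum_prod_type] at h
  simpa [sq] using h

/-- The trace of `m m*` is the squared Hilbert-Schmidt norm. The factor `n ^ 2` comes from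
Cauchy-Schwarz over the entries; it is not sharp, but any positive constant serves. -/
theorem sq_norm_le_trace (m : Matrix (Fin n) (Fin n) ℂ) :
    ‖m‖ ^ 2 ≤ (n : ℝ) ^ 2 * (m * mᴴ).trace.re := by
  rw [trace_mul_conjTranspose_re]
  exact (pow_le_pow_left₀ (norm_nonneg _) (norm_le_sum_norm_entry m) 2).trans
    (sq_sum_sum_le fun i j => ‖m i j‖)

end Norms

/-! ### Trace and contractions on a C*-algebra isomorphic to a matrix algebra. -/

variable {n : ℕ} {B : Type*} [CStarAlgebra B] (Φ Ψ : B ≃⋆ₐ[ℂ] Matrix (Fin n) (Fin n) ℂ)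

open scoped Matrix.Norms.L2Operator in
theorem norm_one_le_of_equiv {n : ℕ} {B : Type*} [CStarAlgebra B]
    (Φ : B ≃⋆ₐ[ℂ] Matrix (Fin n) (Fin n) ℂ) : ‖(1 : B)‖ ≤ 1 := by
  rw [← norm_starAlgEquiv Φ, map_one, ← Matrix.diagonal_one,
    Matrix.l2_opNorm_diagonal, pi_norm_le_iff_of_nonneg zero_le_one]
  intro i
  simp

/-- The matrix units of `B` given by an isomorphism with a matrix algebra. -/
def matrixUnit (i j : Fin n) : B := Φ.symm (Matrix.single i j 1)

@[simp] theorem apply_matrixUnit (i j : Fin n) : Φ (matrixUnit Φ i j) = Matrix.single i j 1 :=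
  Φ.apply_symm_apply _

theorem norm_matrixUnit_le (i j : Fin n) : ‖matrixUnit Φ i j‖ ≤ 1 := by
  rw [← norm_starAlgEquiv Φ, apply_matrixUnit]
  exact norm_single_one_le i j

theorem star_matrixUnit (i j : Fin n) : star (matrixUnit Φ i j) = matrixUnit Φ j i := by
  apply EquivLike.injective Φ
  rw [map_star, apply_matrixUnit, apply_matrixUnit, Matrix.star_eq_conjTranspose,
    Matrix.conjTranspose_single, star_one]

theorem eq_sum_matrixUnit (x : B) : x = ∑ i, ∑ j, Φ x i j • matrixUnit Φ i j := by
  apply EquivLike.injective Φ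
  simp only [map_sum, map_smul, apply_matrixUnit]
  conv_lhs => rw [Matrix.matrix_eq_sum_single (Φ x)]
  simp [Matrix.smul_single]

/-- The trace of an element of an algebra isomorphic to a matrix algebra. -/
def fibreTrace (x : B) : ℂ := (Φ x).trace

theorem fibreTrace_mul_comm (x y : B) : fibreTrace Φ (x * y) = fibreTrace Φ (y * x) := by
  rw [fibreTrace, fibreTrace, map_mul, map_mul, Matrix.trace_mul_comm]

theorem norm_fibreTrace_le (x : B) : ‖fibreTrace Φ x‖ ≤ n * ‖x‖ := by
  rw [← norm_starAlgEquiv Φ]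
  exact norm_trace_le _

theorem continuous_fibreTrace : Continuous (fibreTrace Φ) := by
  let τ : B →ₗ[ℂ] ℂ :=
    { toFun := fibreTrace Φ
      map_add' := fun x y => by simp [fibreTrace]
      map_smul' := fun c x => by simp [fibreTrace] }
  exact (τ.mkContinuous n fun x => norm_fibreTrace_le Φ x).continuous

theorem sq_norm_le_fibreTrace (x : B) :
    ‖x‖ ^ 2 ≤ (n : ℝ) ^ 2 * (fibreTrace Φ (x * star x)).re := by
  rw [← norm_starAlgEquiv Φ, fibreTrace, map_mul, map_star]
  exact sq_norm_le_trace _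

theorem sum_matrixUnit_mul_mul (z : B) :
    ∑ i, ∑ j, matrixUnit Φ i j * z * matrixUnit Φ j i = fibreTrace Φ z • 1 := by
  apply EquivLike.injective Φ
  simp only [map_sum, map_mul, apply_matrixUnit, map_smul, map_one]
  exact sum_single_mul_mul_single _

theorem sum_matrixUnit_self : ∑ i, matrixUnit Φ i i = 1 := by
  apply EquivLike.injective Φ
  simp only [map_sum, apply_matrixUnit, map_one]
  rw [← Matrix.diagonal_one, ← Matrix.sum_single_eq_diagonal]

theorem matrixUnit_mul_matrixUnit (i j : Fin n) :
    matrixUnit Φ j i * matrixUnit Φ i j = matrixUnit Φ j j := by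
  apply EquivLike.injective Φ
  simp

/-- The trace does not depend on the isomorphism with a matrix algebra. -/
theorem fibreTrace_congr (x : B) : fibreTrace Φ x = fibreTrace Ψ x := by
  rcases Nat.eq_zero_or_pos n with rfl | hn
  · simp [fibreTrace, Matrix.trace]
  -- The averaging identity for the units of `Φ` is evaluated under the trace of `Ψ`: cyclicity
  -- gives `n` times one trace, `sum_matrixUnit_mul_mul` gives `n` times the other.
  have h1 : fibreTrace Ψ (∑ i, ∑ j, matrixUnit Φ i j * x * matrixUnit Φ j i) =
      n * fibreTrace Ψ x := by
    have h2 : ∀ i j, fibreTrace Ψ (matrixUnit Φ i j * x * matrixUnit Φ j i) =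
        fibreTrace Ψ (x * matrixUnit Φ j j) := by
      intro i j
      rw [mul_assoc, fibreTrace_mul_comm, mul_assoc, matrixUnit_mul_matrixUnit]
    have h3 : ∀ i : Fin n, ∑ j, fibreTrace Ψ (x * matrixUnit Φ j j) = fibreTrace Ψ x := by
      intro i
      conv_rhs => rw [← mul_one x, ← sum_matrixUnit_self Φ, Finset.mul_sum]
      simp only [fibreTrace, map_sum, Matrix.trace_sum]
    have h4 : fibreTrace Ψ (∑ i, ∑ j, matrixUnit Φ i j * x * matrixUnit Φ j i) =
        ∑ i, ∑ j, fibreTrace Ψ (matrixUnit Φ i j * x * matrixUnit Φ j i) := by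
      simp only [fibreTrace, map_sum, Matrix.trace_sum]
    rw [h4]
    simp only [h2]
    rw [Finset.sum_congr rfl fun i _ => h3 i]
    simp
  rw [sum_matrixUnit_mul_mul] at h1
  have h5 : fibreTrace Ψ (fibreTrace Φ x • (1 : B)) = n * fibreTrace Φ x := by
    rw [fibreTrace, map_smul, map_one, Matrix.trace_smul, Matrix.trace_one, smul_eq_mul,
      Fintype.card_fin, mul_comm]
  have hn' : (n : ℂ) ≠ 0 := by exact_mod_cast hn.ne'
  exact mul_left_cancel₀ hn' (h5.symm.trans h1)

/-- For `f = a · b` this is `tr (b y) • a`. -/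
def leftContraction (f : B → B) (y : B) : B :=
  ∑ i, ∑ j, f (matrixUnit Φ i j) * y * matrixUnit Φ j i

/-- For `f = a · b` this is `tr (y a) • b`. -/
def rightContraction (f : B → B) (y : B) : B :=
  ∑ i, ∑ j, matrixUnit Φ i j * y * f (matrixUnit Φ j i)

theorem leftContraction_mul (a b y : B) :
    leftContraction Φ (fun x => a * x * b) y = fibreTrace Φ (b * y) • a := by
  have h : ∀ i j, a * matrixUnit Φ i j * b * y * matrixUnit Φ j i =
      a * (matrixUnit Φ i j * (b * y) * matrixUnit Φ j i) := fun i j => by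
    simp only [mul_assoc]
  simp only [leftContraction, h]
  simp only [← Finset.mul_sum]
  rw [sum_matrixUnit_mul_mul, mul_smul_comm, mul_one]

theorem rightContraction_mul (a b y : B) :
    rightContraction Φ (fun x => a * x * b) y = fibreTrace Φ (y * a) • b := by
  have h : ∀ i j, matrixUnit Φ i j * y * (a * matrixUnit Φ j i * b) =
      (matrixUnit Φ i j * (y * a) * matrixUnit Φ j i) * b := fun i j => by
    simp only [mul_assoc]
  simp only [rightContraction, h]
  simp only [← Finset.sum_mul]
  rw [sum_matrixUnit_mul_mul, smul_mul_assoc, one_mul]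

/-- Both sides are `tr(b y) tr(z a) a x b`. Writing the scalar through the left contraction
expresses the identity in terms of the operator alone, so that it can survive a limit. -/
theorem contraction_mul_contraction (a b y z x : B) :
    leftContraction Φ (fun x => a * x * b) y * x * rightContraction Φ (fun x => a * x * b) z =
      fibreTrace Φ (leftContraction Φ (fun x => a * x * b) y * z) • (a * x * b) := by
  rw [leftContraction_mul, rightContraction_mul, smul_mul_assoc (r := fibreTrace Φ (b * y)) a z,
    show fibreTrace Φ (fibreTrace Φ (b * y) • (a * z)) = fibreTrace Φ (b * y) *
      fibreTrace Φ (z * a) by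
      rw [fibreTrace_mul_comm Φ z a, fibreTrace, map_smul, Matrix.trace_smul, smul_eq_mul]; rfl]
  simp only [smul_mul_assoc, mul_smul_comm, smul_smul]
  rw [mul_comm]

theorem norm_sum_sum_le {M : ℝ} {g : Fin n → Fin n → B} (h : ∀ i j, ‖g i j‖ ≤ M) :
    ‖∑ i, ∑ j, g i j‖ ≤ (n : ℝ) ^ 2 * M := by
  have h1 : ‖∑ i, ∑ j, g i j‖ ≤ ∑ _i : Fin n, ∑ _j : Fin n, M :=
    (norm_sum_le _ _).trans (Finset.sum_le_sum fun i _ =>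
      (norm_sum_le _ _).trans (Finset.sum_le_sum fun j _ => h i j))
  simpa [sq, mul_assoc] using h1

theorem norm_leftContraction_le {M : ℝ} {f : B → B} (hf : ∀ x, ‖f x‖ ≤ M * ‖x‖) (hM : 0 ≤ M)
    (y : B) : ‖leftContraction Φ f y‖ ≤ (n : ℝ) ^ 2 * (M * ‖y‖) := by
  refine norm_sum_sum_le fun i j => ?_
  have h1 : ‖f (matrixUnit Φ i j)‖ ≤ M :=
    (hf _).trans (mul_le_of_le_one_right hM (norm_matrixUnit_le Φ i j))
  refine (norm_mul_le _ _).trans ((mul_le_of_le_one_right (norm_nonneg _)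
    (norm_matrixUnit_le Φ j i)).trans ((norm_mul_le _ _).trans ?_))
  gcongr

theorem norm_rightContraction_le {M : ℝ} {f : B → B} (hf : ∀ x, ‖f x‖ ≤ M * ‖x‖) (hM : 0 ≤ M)
    (y : B) : ‖rightContraction Φ f y‖ ≤ (n : ℝ) ^ 2 * (M * ‖y‖) := by
  refine norm_sum_sum_le fun i j => ?_
  have h1 : ‖f (matrixUnit Φ j i)‖ ≤ M :=
    (hf _).trans (mul_le_of_le_one_right hM (norm_matrixUnit_le Φ j i))
  have h2 : ‖matrixUnit Φ i j * y‖ ≤ ‖y‖ := (norm_mul_le _ _).trans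
    (mul_le_of_le_one_left (norm_nonneg _) (norm_matrixUnit_le Φ i j))
  refine (norm_mul_le _ _).trans ?_
  rw [mul_comm]
  exact mul_le_mul h1 h2 (norm_nonneg _) hM

/-- A lower bound for the Hilbert-Schmidt inner product of an operator `f` with a two-sided
multiplication `c · d` close to it. -/
theorem re_fibreTrace_leftContraction_ge (hn : 0 < n) {f : B →L[ℂ] B} {M η δ : ℝ} {c d : B}
    (hδ : 0 ≤ δ) (hfδ : δ ≤ ‖f‖) (hfM : ‖f‖ ≤ M)
    (hη : ∀ x, ‖f x - c * x * d‖ ≤ η * ‖x‖) (hη0 : 0 ≤ η) :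
    δ ^ 2 / (n : ℝ) ^ 4 - (n : ℝ) ^ 3 * (M * η) ≤
      (fibreTrace Φ (leftContraction Φ f (star d) * star c)).re := by
  set u := matrixUnit Φ with hu
  have hn' : (0 : ℝ) < n := by exact_mod_cast hn
  have hM : 0 ≤ M := (norm_nonneg f).trans hfM
  have hadd : ∀ x y, fibreTrace Φ (x - y) = fibreTrace Φ x - fibreTrace Φ y := fun x y => by
    rw [fibreTrace, map_sub, Matrix.trace_sub]; rfl
  -- Since `e_ij* = e_ji`, contracting against `d*` and `c*` produces the Hilbert-Schmidt inner
  -- product of `f` with `c · d`.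
  have hsum : fibreTrace Φ (leftContraction Φ f (star d) * star c) =
      ∑ i, ∑ j, fibreTrace Φ (f (u i j) * star (c * u i j * d)) := by
    simp only [leftContraction, Finset.sum_mul]
    simp only [fibreTrace, map_sum, Matrix.trace_sum, star_mul, hu, star_matrixUnit, mul_assoc]
  have hterm : ∀ i j, ‖f (u i j)‖ ^ 2 / (n : ℝ) ^ 2 - n * (M * η) ≤
      (fibreTrace Φ (f (u i j) * star (c * u i j * d))).re := by
    intro i j
    have hu1 : ‖u i j‖ ≤ 1 := norm_matrixUnit_le Φ i j
    have e1 : f (u i j) * star (c * u i j * d) = f (u i j) * star (f (u i j)) -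
        f (u i j) * star (f (u i j) - c * u i j * d) := by
      rw [star_sub, mul_sub]; abel
    have e2 := sq_norm_le_fibreTrace Φ (f (u i j))
    have e3 : (fibreTrace Φ (f (u i j) * star (f (u i j) - c * u i j * d))).re ≤
        n * (M * η) := by
      refine (Complex.re_le_norm _).trans ((norm_fibreTrace_le Φ _).trans ?_)
      refine mul_le_mul_of_nonneg_left ((norm_mul_le _ _).trans ?_) hn'.le
      rw [norm_star]
      refine mul_le_mul ?_ ?_ (norm_nonneg _) hM
      · exact ((f.le_opNorm _).trans (mul_le_of_le_one_right (norm_nonneg _) hu1)).trans hfM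
      · exact (hη _).trans (mul_le_of_le_one_right hη0 hu1)
    rw [e1, hadd, Complex.sub_re]
    refine sub_le_sub ?_ e3
    rw [div_le_iff₀ (by positivity), mul_comm]
    exact e2
  -- Expanding `x` in matrix units, with coefficients at most `‖x‖`, bounds the operator norm of `f`
  -- by the sum of its values on the units.
  have hδs : δ ≤ ∑ i, ∑ j, ‖f (u i j)‖ := by
    refine hfδ.trans (f.opNorm_le_bound (by positivity) fun x => ?_)
    conv_lhs => rw [eq_sum_matrixUnit Φ x]
    simp only [map_sum, map_smul]
    rw [Finset.sum_mul]
    refine (norm_sum_le _ _).trans (Finset.sum_le_sum fun i _ => ?_)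
    rw [Finset.sum_mul]
    refine (norm_sum_le _ _).trans (Finset.sum_le_sum fun j _ => ?_)
    rw [norm_smul, mul_comm, ← norm_starAlgEquiv Φ x]
    exact mul_le_mul_of_nonneg_left (norm_entry_le _ i j) (norm_nonneg _)
  have hsq : δ ^ 2 ≤ (n : ℝ) ^ 2 * ∑ i, ∑ j, ‖f (u i j)‖ ^ 2 :=
    (pow_le_pow_left₀ hδ hδs 2).trans (sq_sum_sum_le _)
  have htot : ∑ i : Fin n, ∑ j : Fin n, (‖f (u i j)‖ ^ 2 / (n : ℝ) ^ 2 - n * (M * η)) ≤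
      (fibreTrace Φ (leftContraction Φ f (star d) * star c)).re := by
    rw [hsum, Complex.re_sum]
    refine Finset.sum_le_sum fun i _ => ?_
    rw [Complex.re_sum]
    exact Finset.sum_le_sum fun j _ => hterm i j
  refine le_trans ?_ htot
  -- The `n ^ 2` error terms, each `n * (M * η)`, give the factor `n ^ 3`; the `n ^ 4` is `n ^ 2`
  -- from `hterm` times `n ^ 2` from `hsq`.
  simp only [Finset.sum_sub_distrib, ← Finset.sum_div, Finset.sum_const, Finset.card_univ,
    Fintype.card_fin, nsmul_eq_mul]
  refine sub_le_sub ?_ (le_of_eq (by ring))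
  rw [div_le_div_iff₀ (by positivity) (by positivity)]
  calc δ ^ 2 * (n : ℝ) ^ 2 ≤ ((n : ℝ) ^ 2 * ∑ i, ∑ j, ‖f (u i j)‖ ^ 2) * (n : ℝ) ^ 2 := by gcongr
    _ = _ := by ring

end MatrixAlgebra

/-! ### Continuous sections, and multipliers as bounded continuous sections. -/

section Bundles

variable (n : ℕ) {X : Type u} [TopologicalSpace X] (E : X → Type v)
    [∀ t, CStarAlgebra (E t)] [TopologicalSpace (TotalSpace (Matrix (Fin n) (Fin n) ℂ) E)]
    [FiberBundle (Matrix (Fin n) (Fin n) ℂ) E]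

variable {n E} in
theorem continuousSection_of_eventuallyEq {s : ∀ t, E t}
    (h : ∀ t₀, ∃ s' : ∀ t, E t, ContinuousSection n s' ∧ ∀ᶠ t in 𝓝 t₀, s t = s' t) :
    ContinuousSection n s := by
  rw [continuousSection_iff]
  intro t₀
  obtain ⟨s', hs', he⟩ := h t₀
  refine ((continuousSection_iff n _).1 hs' t₀).congr ?_
  filter_upwards [he] with t ht
  rw [ht]

variable [MatrixBundle n E]

/-- A chosen identification of a fibre with the matrix algebra. -/
def fibreEquiv (t : X) : E t ≃⋆ₐ[ℂ] Matrix (Fin n) (Fin n) ℂ :=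
  (eventually_exists_chart_eq n E t).self_of_nhds.choose

variable {n E}

theorem nontrivial_fibre (hn : 0 < n) (t : X) : Nontrivial (E t) := by
  have : Nonempty (Fin n) := ⟨⟨0, hn⟩⟩
  exact (fibreEquiv n E t).toEquiv.nontrivial

theorem ContinuousSection.sum {ι : Type*} (S : Finset ι) {s : ι → ∀ t, E t}
    (h : ∀ i, ContinuousSection n (s i)) : ContinuousSection n fun t => ∑ i ∈ S, s i t := by
  classical
  induction S using Finset.induction_on with
  | empty => exact ContinuousSection.zero (E := E) n
  | insert a S ha ih =>
    simp only [Finset.sum_insert ha]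
    exact (h a).add n ih

open scoped Matrix.Norms.L2Operator in
theorem ContinuousSection.continuous_norm {s : ∀ t, E t} (h : ContinuousSection n s) :
    Continuous fun t => ‖s t‖ := by
  rw [continuous_iff_continuousAt]
  intro t₀
  refine ((continuousSection_iff n _).1 h t₀).norm.congr ?_
  filter_upwards [eventually_exists_chart_eq n E t₀] with t ⟨Φ, hΦ⟩
  rw [hΦ, norm_starAlgEquiv]

/-- The isomorphisms `fibreEquiv` are chosen point by point, with no continuity in `t`. Independence
of the trace from the isomorphism allows replacing them by a single chart near `t₀`. -/
theorem ContinuousSection.continuous_fibreTrace {s : ∀ t, E t} (h : ContinuousSection n s) :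
    Continuous fun t => fibreTrace (fibreEquiv n E t) (s t) := by
  rw [continuous_iff_continuousAt]
  intro t₀
  have h1 : ContinuousAt (fun t => (chart n E t₀ t (s t)).trace) t₀ :=
    (Continuous.matrix_trace continuous_id).continuousAt.comp
      ((continuousSection_iff n _).1 h t₀)
  refine h1.congr ?_
  filter_upwards [eventually_exists_chart_eq n E t₀] with t ⟨Φ, hΦ⟩
  rw [hΦ, fibreTrace_congr _ Φ, fibreTrace]

theorem Gamma0.continuousSection (a : Gamma0 n E) : ContinuousSection n a.val := a.2.1

theorem Gamma0.tendsto_norm (a : Gamma0 n E) :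
    Tendsto (fun t => ‖a.val t‖) (cocompact X) (𝓝 0) := a.2.2

@[simp] theorem Gamma0.val_mul (a b : Gamma0 n E) (t : X) : (a * b).val t = a.val t * b.val t := rfl

theorem Gamma0.ext {a b : Gamma0 n E} (h : ∀ t, a.val t = b.val t) : a = b :=
  Subtype.ext (lp.ext (funext h))

theorem Gamma0.norm_le {a : Gamma0 n E} {C : ℝ} (hC : 0 ≤ C) (h : ∀ t, ‖a.val t‖ ≤ C) : ‖a‖ ≤ C :=
  lp.norm_le_of_forall_le hC h

theorem exists_gamma0_of_dominated {s : ∀ t, E t} (hs : ContinuousSection n s) (a : Gamma0 n E)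
    {C : ℝ} (h : ∀ t, ‖s t‖ ≤ C * ‖a.val t‖) : ∃ b : Gamma0 n E, ∀ t, b.val t = s t := by
  have hC : ∀ t, ‖s t‖ ≤ |C| * ‖a.val t‖ := fun t =>
    (h t).trans (mul_le_mul_of_nonneg_right (le_abs_self C) (norm_nonneg _))
  have hmem : Memℓp s ∞ := memℓp_infty ⟨|C| * ‖a‖, by
    rintro _ ⟨t, rfl⟩
    exact (hC t).trans (mul_le_mul_of_nonneg_left (a.norm_val_le t) (abs_nonneg C))⟩
  refine ⟨⟨⟨s, hmem⟩, hs, ?_⟩, fun t => rfl⟩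
  have h0 := a.tendsto_norm.const_mul |C|
  rw [mul_zero] at h0
  exact squeeze_zero (fun _ => norm_nonneg _) hC h0

/-- A bounded continuous section of the bundle defines a multiplier of `Γ₀(E)`. -/
theorem exists_doubleCentralizer {m : ∀ t, E t} (hm : ContinuousSection n m) {C : ℝ}
    (hC : ∀ t, ‖m t‖ ≤ C) : ∃ a : DoubleCentralizer ℂ (Gamma0 n E),
      (∀ x t, (a.fst x).val t = m t * x.val t) ∧ ∀ x t, (a.snd x).val t = x.val t * m t := by
  have hl : ∀ (x : Gamma0 n E) t, ‖m t * x.val t‖ ≤ |C| * ‖x.val t‖ := fun x t =>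
    (norm_mul_le _ _).trans
      (mul_le_mul_of_nonneg_right ((hC t).trans (le_abs_self C)) (norm_nonneg _))
  have hr : ∀ (x : Gamma0 n E) t, ‖x.val t * m t‖ ≤ |C| * ‖x.val t‖ := fun x t => by
    refine (norm_mul_le _ _).trans ?_
    rw [mul_comm]
    exact mul_le_mul_of_nonneg_right ((hC t).trans (le_abs_self C)) (norm_nonneg _)
  choose l hl' using fun x : Gamma0 n E =>
    exists_gamma0_of_dominated (hm.mul n x.continuousSection) x (hl x)
  choose r hr' using fun x : Gamma0 n E =>
    exists_gamma0_of_dominated (x.continuousSection.mul n hm) x (hr x)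
  have hl'' : ∀ x t, (l x).val t = m t * x.val t := hl'
  have hr'' : ∀ x t, (r x).val t = x.val t * m t := hr'
  let L : Gamma0 n E →L[ℂ] Gamma0 n E := LinearMap.mkContinuous
    { toFun := l
      map_add' := fun x y => Gamma0.ext fun t => by
        change (l (x + y)).val t = (l x).val t + (l y).val t
        rw [hl'', hl'', hl'', ← mul_add]; rfl
      map_smul' := fun c x => Gamma0.ext fun t => by
        change (l (c • x)).val t = c • (l x).val t
        rw [hl'', hl'', ← mul_smul_comm]; rfl } |C| fun x =>
    Gamma0.norm_le (by positivity) fun t => by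
      change ‖(l x).val t‖ ≤ _
      rw [hl'']
      exact (hl x t).trans (mul_le_mul_of_nonneg_left (x.norm_val_le t) (abs_nonneg C))
  let R : Gamma0 n E →L[ℂ] Gamma0 n E := LinearMap.mkContinuous
    { toFun := r
      map_add' := fun x y => Gamma0.ext fun t => by
        change (r (x + y)).val t = (r x).val t + (r y).val t
        rw [hr'', hr'', hr'', ← add_mul]; rfl
      map_smul' := fun c x => Gamma0.ext fun t => by
        change (r (c • x)).val t = c • (r x).val t
        rw [hr'', hr'', ← smul_mul_assoc]; rfl } |C| fun x =>
    Gamma0.norm_le (by positivity) fun t => by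
      change ‖(r x).val t‖ ≤ _
      rw [hr'']
      exact (hr x t).trans (mul_le_mul_of_nonneg_left (x.norm_val_le t) (abs_nonneg C))
  refine ⟨⟨(L, R), fun x y => Gamma0.ext fun t => ?_⟩, hl'', hr''⟩
  change (r x).val t * y.val t = x.val t * (l y).val t
  rw [hr'', hl'', mul_assoc]

variable [T2Space X] [LocallyCompactSpace X]

open scoped Matrix.Norms.L2Operator in
/-- There are sections of `Γ₀(E)` that are constant in a given chart near its centre. -/
theorem exists_section_chart_eventuallyEq (t₀ : X) (m : Matrix (Fin n) (Fin n) ℂ) :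
    ∃ a : Gamma0 n E, ∀ᶠ t in 𝓝 t₀, chart n E t₀ t (a.val t) = m := by
  set e := trivializationAt (Matrix (Fin n) (Fin n) ℂ) E t₀ with he
  have ht₀ : t₀ ∈ e.baseSet := FiberBundle.mem_baseSet_trivializationAt' t₀
  obtain ⟨K, hK, hKt, hKe⟩ := exists_compact_subset e.open_baseSet ht₀
  -- A second compact neighbourhood makes the cutoff equal to one near `t₀`, and not merely at `t₀`.
  obtain ⟨K', hK', hKt', hKK⟩ := exists_compact_subset (isOpen_interior (s := K)) hKt
  obtain ⟨f, hf1, hf0, -, hf01⟩ := exists_continuous_one_zero_of_isCompact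
    hK' (isOpen_interior (s := K)).isClosed_compl
    (Set.disjoint_compl_right_iff_subset.2 hKK)
  have hf0' : ∀ t ∉ K, f t = 0 := fun t ht => hf0 fun h => ht (interior_subset h)
  set s : ∀ t, E t := fun t => (f t : ℂ) • e.symm t m with hs
  have hs0 : ∀ t ∉ K, s t = 0 := fun t ht => by simp [hs, hf0' t ht]
  have hsymm : ∀ t ∈ e.baseSet, chart n E t₀ t (e.symm t m) = m := fun t ht =>
    congrArg Prod.snd (e.apply_mk_symm ht m)
  have hnorm : ∀ t, ‖s t‖ ≤ ‖m‖ := by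
    intro t
    by_cases ht : t ∈ K
    · obtain ⟨Φ, hΦ⟩ := exists_chart_eq n E (hKe ht)
      have h2 : ‖e.symm t m‖ = ‖m‖ := by
        rw [← norm_starAlgEquiv Φ, ← hΦ, hsymm t (hKe ht)]
      rw [hs, norm_smul, h2, Complex.norm_real, Real.norm_eq_abs, abs_of_nonneg (hf01 t).1]
      exact mul_le_of_le_one_left (norm_nonneg _) (hf01 t).2
    · rw [hs0 t ht, norm_zero]
      exact norm_nonneg _
  have hcont : ContinuousSection n s := by
    rw [continuousSection_iff]
    intro t₁
    by_cases ht : t₁ ∈ K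
    · have h1 : ContinuousAt (fun t => TotalSpace.mk' (Matrix (Fin n) (Fin n) ℂ) t
          (e.symm t m)) t₁ := by
        have h2 := e.continuousOn_symm.continuousAt (x := (t₁, m))
          ((e.open_baseSet.prod isOpen_univ).mem_nhds ⟨hKe ht, trivial⟩)
        exact h2.comp (f := fun t => (t, m)) (continuousAt_id.prodMk continuousAt_const)
      have h3 := ((FiberBundle.continuousAt_totalSpace _ _).1 h1).2
      have h4 : ContinuousAt (fun t => (f t : ℂ)) t₁ :=
        (Complex.continuous_ofReal.comp f.continuous).continuousAt
      refine (h4.smul h3).congr ?_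
      filter_upwards [eventually_exists_chart_eq n E t₁] with t ⟨Φ, hΦ⟩
      rw [hΦ, hs, map_smul, ← hΦ]
      rfl
    · have h1 := (continuousSection_iff n _).1 (ContinuousSection.zero (E := E) n) t₁
      refine h1.congr ?_
      filter_upwards [hK.isClosed.isOpen_compl.mem_nhds ht] with t ht'
      rw [hs0 t ht']
      rfl
  have hmem : Memℓp s ∞ := memℓp_infty ⟨‖m‖, by rintro _ ⟨t, rfl⟩; exact hnorm t⟩
  refine ⟨⟨⟨s, hmem⟩, hcont, ?_⟩, ?_⟩
  · refine tendsto_const_nhds.congr' ?_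
    filter_upwards [hK.compl_mem_cocompact] with t ht
    exact (norm_eq_zero.2 (hs0 t ht)).symm
  · filter_upwards [mem_interior_iff_mem_nhds.1 hKt'] with t ht
    have h1 : f t = 1 := hf1 ht
    change chart n E t₀ t (s t) = m
    rw [hs]
    simp only [h1, Complex.ofReal_one, one_smul]
    exact hsymm t (hKe (interior_subset (hKK ht)))

theorem exists_section_eventuallyEq_one (t₀ : X) :
    ∃ a : Gamma0 n E, ∀ᶠ t in 𝓝 t₀, a.val t = 1 := by
  obtain ⟨a, ha⟩ := exists_section_chart_eventuallyEq (n := n) (E := E) t₀ 1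
  refine ⟨a, ?_⟩
  filter_upwards [ha, eventually_exists_chart_eq n E t₀] with t ht ⟨Φ, hΦ⟩
  apply EquivLike.injective Φ
  rw [← hΦ, ht, map_one]

/-! ### Values of multipliers -/

/-- A section in `Γ₀(E)` through a given point of a fibre. -/
def lift (t : X) (v : E t) : Gamma0 n E := (exists_section n E t v).choose

@[simp] theorem lift_val (t : X) (v : E t) : (lift t v : Gamma0 n E).val t = v :=
  (exists_section n E t v).choose_spec.1

theorem norm_lift_le (t : X) (v : E t) : ‖(lift t v : Gamma0 n E)‖ ≤ ‖v‖ :=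
  (exists_section n E t v).choose_spec.2

/-- The value at a point of a multiplier of `Γ₀(E)`. -/
def multiplierVal (a : DoubleCentralizer ℂ (Gamma0 n E)) (t : X) : E t :=
  (a.fst (lift t 1)).val t

/-- This is the centralizer identity `(x a) y = x (a y)` evaluated at `t`, with `y` a section whose
value there is one. -/
theorem snd_val (a : DoubleCentralizer ℂ (Gamma0 n E)) (x : Gamma0 n E) (t : X) :
    (a.snd x).val t = x.val t * multiplierVal a t := by
  have h := congrArg (fun y => Gamma0.val y t) (a.central x (lift t 1))
  simpa [multiplierVal] using h

theorem fst_val (a : DoubleCentralizer ℂ (Gamma0 n E)) (x : Gamma0 n E) (t : X) :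
    (a.fst x).val t = multiplierVal a t * x.val t := by
  have h := congrArg (fun y => Gamma0.val y t) (a.central (lift t 1) x)
  simpa [snd_val] using h.symm

theorem continuousSection_multiplierVal (a : DoubleCentralizer ℂ (Gamma0 n E)) :
    ContinuousSection n (multiplierVal a) := by
  refine continuousSection_of_eventuallyEq fun t₀ => ?_
  obtain ⟨s, hs⟩ := exists_section_eventuallyEq_one (E := E) (n := n) t₀
  refine ⟨(a.fst s).val, (a.fst s).continuousSection, ?_⟩
  filter_upwards [hs] with t ht
  rw [fst_val, ht, mul_one]

theorem norm_multiplierVal_le (a : DoubleCentralizer ℂ (Gamma0 n E)) (t : X) :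
    ‖multiplierVal a t‖ ≤ ‖a.fst‖ := by
  refine (Gamma0.norm_val_le _ t).trans ?_
  exact a.fst.le_of_opNorm_le_of_le le_rfl ((norm_lift_le t 1).trans (norm_one_le_of_equiv (fibreEquiv n E t)))
    |>.trans (mul_one _).le

theorem twoSidedMul_val (a b : DoubleCentralizer ℂ (Gamma0 n E)) (x : Gamma0 n E) (t : X) :
    (twoSidedMul a b x).val t = multiplierVal a t * x.val t * multiplierVal b t := by
  change (a.fst (b.snd x)).val t = _
  rw [fst_val, snd_val, mul_assoc]

end Bundles

/-! ### Fibrewise identities for limits of two-sided multiplications. -/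

section Operators

variable {n : ℕ} {X : Type u} [TopologicalSpace X] {E : X → Type v}
    [∀ t, CStarAlgebra (E t)] [TopologicalSpace (TotalSpace (Matrix (Fin n) (Fin n) ℂ) E)]
    [FiberBundle (Matrix (Fin n) (Fin n) ℂ) E] [MatrixBundle n E]

theorem Gamma0.continuous_val (t : X) : Continuous fun a : Gamma0 n E => a.val t := by
  refine LipschitzWith.continuous (K := 1) (LipschitzWith.of_dist_le_mul fun a b => ?_)
  rw [NNReal.coe_one, one_mul, dist_eq_norm, dist_eq_norm]
  exact (a - b).norm_val_le t

variable [T2Space X] [LocallyCompactSpace X]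

/-- The values on `E t` of an operator on `Γ₀(E)`; this is `fibreOp φ _ t` for `φ` in
`IB(Γ₀(E))`. -/
def opAt (φ : Gamma0 n E →L[ℂ] Gamma0 n E) (t : X) (v : E t) : E t := (φ (lift t v)).val t

theorem opAt_val {φ : Gamma0 n E →L[ℂ] Gamma0 n E} (hφ : φ ∈ IB (Gamma0 n E)) (t : X)
    (a : Gamma0 n E) : opAt φ t (a.val t) = (φ a).val t := fibreOp_val hφ t a

theorem norm_opAt_le (φ : Gamma0 n E →L[ℂ] Gamma0 n E) (t : X) (v : E t) :
    ‖opAt φ t v‖ ≤ ‖φ‖ * ‖v‖ :=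
  (Gamma0.norm_val_le _ t).trans (φ.le_opNorm_of_le (norm_lift_le t v))

/-- As `opAt` requires no ideal preservation, it is continuous on the whole operator space; the
closure arguments below rest on this. -/
theorem continuous_opAt (t : X) (v : E t) :
    Continuous fun φ : Gamma0 n E →L[ℂ] Gamma0 n E => opAt φ t v :=
  (Gamma0.continuous_val t).comp (ContinuousLinearMap.apply ℂ _ (lift t v)).continuous

theorem opAt_twoSidedMul (a b : DoubleCentralizer ℂ (Gamma0 n E)) (t : X) :
    opAt (twoSidedMul a b) t = fun v => multiplierVal a t * v * multiplierVal b t := by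
  funext v
  rw [opAt, twoSidedMul_val, lift_val]

section Contractions

variable {t : X} (Φ Ψ : E t ≃⋆ₐ[ℂ] Matrix (Fin n) (Fin n) ℂ)

theorem continuous_leftContraction (y : E t) :
    Continuous fun φ : Gamma0 n E →L[ℂ] Gamma0 n E => leftContraction Φ (opAt φ t) y :=
  continuous_finsetSum _ fun _ _ => continuous_finsetSum _ fun _ _ =>
    ((continuous_opAt t _).mul continuous_const).mul continuous_const

theorem continuous_rightContraction (y : E t) :
    Continuous fun φ : Gamma0 n E →L[ℂ] Gamma0 n E => rightContraction Φ (opAt φ t) y :=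
  continuous_finsetSum _ fun _ _ => continuous_finsetSum _ fun _ _ =>
    continuous_const.mul (continuous_opAt t _)

variable {φ : Gamma0 n E →L[ℂ] Gamma0 n E} (hφ : φ ∈ closure (TM (Gamma0 n E)))
include hφ

/-- On two-sided multiplications the contraction depends on the isomorphism only through the trace,
and equality is a closed condition on `φ`. -/
theorem leftContraction_congr (y : E t) :
    leftContraction Φ (opAt φ t) y = leftContraction Ψ (opAt φ t) y := by
  refine closure_minimal (t := {φ | leftContraction Φ (opAt φ t) y =
    leftContraction Ψ (opAt φ t) y}) ?_
    (isClosed_eq (continuous_leftContraction Φ y) (continuous_leftContraction Ψ y)) hφ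
  rintro _ ⟨a, b, rfl⟩
  rw [Set.mem_ofPred_eq, opAt_twoSidedMul, leftContraction_mul, leftContraction_mul,
    fibreTrace_congr Φ Ψ]

theorem rightContraction_congr (y : E t) :
    rightContraction Φ (opAt φ t) y = rightContraction Ψ (opAt φ t) y := by
  refine closure_minimal (t := {φ | rightContraction Φ (opAt φ t) y =
    rightContraction Ψ (opAt φ t) y}) ?_
    (isClosed_eq (continuous_rightContraction Φ y) (continuous_rightContraction Ψ y)) hφ
  rintro _ ⟨a, b, rfl⟩
  rw [Set.mem_ofPred_eq, opAt_twoSidedMul, rightContraction_mul, rightContraction_mul,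
    fibreTrace_congr Φ Ψ]

/-- Up to a scalar, an operator in the norm closure of the two-sided multiplications is fibrewise
the two-sided multiplication by its contractions. -/
theorem leftContraction_mul_rightContraction (x y z : E t) :
    leftContraction Φ (opAt φ t) y * x * rightContraction Φ (opAt φ t) z =
      fibreTrace Φ (leftContraction Φ (opAt φ t) y * z) • opAt φ t x := by
  refine closure_minimal (t := {φ | leftContraction Φ (opAt φ t) y * x *
    rightContraction Φ (opAt φ t) z =
      fibreTrace Φ (leftContraction Φ (opAt φ t) y * z) • opAt φ t x}) ?_
    (isClosed_eq ?_ ?_) hφ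
  · rintro _ ⟨a, b, rfl⟩
    rw [Set.mem_ofPred_eq, opAt_twoSidedMul]
    exact contraction_mul_contraction Φ _ _ y z x
  · exact ((continuous_leftContraction Φ y).mul continuous_const).mul
      (continuous_rightContraction Φ z)
  · exact ((continuous_fibreTrace Φ).comp
      ((continuous_leftContraction Φ y).mul continuous_const)).smul (continuous_opAt t x)

end Contractions

/-- Near a point there are sections which restrict to matrix units on the fibres. -/
theorem exists_section_matrixUnit (t₀ : X) : ∃ s : Fin n → Fin n → Gamma0 n E,
    ∀ᶠ t in 𝓝 t₀, ∃ Φ : E t ≃⋆ₐ[ℂ] Matrix (Fin n) (Fin n) ℂ,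
      ∀ i j, matrixUnit Φ i j = (s i j).val t := by
  choose s hs using fun i j : Fin n =>
    exists_section_chart_eventuallyEq (n := n) (E := E) t₀ (Matrix.single i j 1)
  refine ⟨s, ?_⟩
  filter_upwards [eventually_all.2 fun i => eventually_all.2 (hs i),
    eventually_exists_chart_eq n E t₀] with t ht ⟨Φ, hΦ⟩
  refine ⟨Φ, fun i j => EquivLike.injective Φ ?_⟩
  rw [apply_matrixUnit, ← hΦ, ht]

/-- An operator which is fibrewise a two-sided multiplication, up to a continuous scalar bounded
away from zero, with coefficients given by bounded continuous sections, is a two-sided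
multiplication. -/
theorem mem_TM_of_sections {φ : Gamma0 n E →L[ℂ] Gamma0 n E} (hφ : φ ∈ IB (Gamma0 n E))
    {l r : ∀ t, E t} (hl : ContinuousSection n l) (hr : ContinuousSection n r) {lam : X → ℂ}
    (hlam : Continuous lam) {κ Cl Cr : ℝ} (hκ : 0 < κ) (hlamκ : ∀ t, κ ≤ ‖lam t‖)
    (hCl : ∀ t, ‖l t‖ ≤ Cl) (hCr : ∀ t, ‖r t‖ ≤ Cr)
    (h : ∀ t x, l t * x * r t = lam t • opAt φ t x) : φ ∈ TM (Gamma0 n E) := by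
  have hlam0 : ∀ t, lam t ≠ 0 := fun t => norm_pos_iff.1 (hκ.trans_le (hlamκ t))
  have hbd : ∀ t, ‖(lam t)⁻¹ • l t‖ ≤ κ⁻¹ * Cl := fun t => by
    rw [norm_smul, norm_inv]
    exact mul_le_mul (inv_anti₀ hκ (hlamκ t)) (hCl t) (norm_nonneg _) (inv_nonneg.2 hκ.le)
  obtain ⟨a, ha, -⟩ := exists_doubleCentralizer
    (ContinuousSection.smul n (hlam.inv₀ hlam0) hl) hbd
  obtain ⟨b, -, hb⟩ := exists_doubleCentralizer hr hCr
  refine ⟨a, b, ContinuousLinearMap.ext fun x => Gamma0.ext fun t => ?_⟩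
  change _ = (a.fst (b.snd x)).val t
  rw [ha, hb, smul_mul_assoc, ← mul_assoc, h, smul_smul, Pi.inv_apply, inv_mul_cancel₀ (hlam0 t), one_smul,
    opAt_val hφ]

/-- Lifting a vector to a section does not increase its norm, so closeness of `φ` to `M_{c,d}` holds
on every fibre with the same constant. -/
theorem re_fibreTrace_ge_of_close {φ : Gamma0 n E →L[ℂ] Gamma0 n E} (hφ : φ ∈ IB (Gamma0 n E))
    (hn : 0 < n) {c d : DoubleCentralizer ℂ (Gamma0 n E)} {δ η : ℝ} {t : X} (hδ : 0 ≤ δ)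
    (h : δ ≤ ‖fibreOp φ hφ t‖) (hη : ‖φ - twoSidedMul c d‖ ≤ η) :
    δ ^ 2 / (n : ℝ) ^ 4 - (n : ℝ) ^ 3 * (‖φ‖ * η) ≤
      (fibreTrace (fibreEquiv n E t) (leftContraction (fibreEquiv n E t) (opAt φ t)
        (star (multiplierVal d t)) * star (multiplierVal c t))).re := by
  have hf : ⇑(fibreOp φ hφ t) = opAt φ t := rfl
  have hM : ‖fibreOp φ hφ t‖ ≤ ‖φ‖ :=
    ContinuousLinearMap.opNorm_le_bound _ (norm_nonneg φ) fun v => norm_opAt_le φ t v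
  have hclose : ∀ x, ‖fibreOp φ hφ t x - multiplierVal c t * x * multiplierVal d t‖ ≤
      η * ‖x‖ := fun x => by
    have e1 : fibreOp φ hφ t x - multiplierVal c t * x * multiplierVal d t =
        opAt (φ - twoSidedMul c d) t x :=
      congrArg (opAt φ t x - ·) (congrFun (opAt_twoSidedMul c d t) x).symm
    rw [e1]
    exact (norm_opAt_le _ t x).trans (mul_le_mul_of_nonneg_right hη (norm_nonneg x))
  have := re_fibreTrace_leftContraction_ge (fibreEquiv n E t) hn hδ h hM hclose
    ((norm_nonneg _).trans hη)
  rwa [hf] at this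

variable {φ : Gamma0 n E →L[ℂ] Gamma0 n E} (hφ : φ ∈ closure (TM (Gamma0 n E)))
include hφ

/-- Near `t₀` the matrix units may be taken to be values of sections `s i j`; the contraction then
becomes a finite sum of products of sections. -/
theorem continuousSection_leftContraction {y : ∀ t, E t} (hy : ContinuousSection n y) :
    ContinuousSection n fun t => leftContraction (fibreEquiv n E t) (opAt φ t) (y t) := by
  refine continuousSection_of_eventuallyEq fun t₀ => ?_
  obtain ⟨s, hs⟩ := exists_section_matrixUnit (n := n) (E := E) t₀
  refine ⟨fun t => ∑ i, ∑ j, (φ (s i j)).val t * y t * (s j i).val t, ?_, ?_⟩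
  · exact ContinuousSection.sum _ fun i => ContinuousSection.sum _ fun j =>
      ((φ (s i j)).continuousSection.mul n hy).mul n (s j i).continuousSection
  · filter_upwards [hs] with t ⟨Φ, hΦ⟩
    rw [leftContraction_congr _ Φ hφ, leftContraction]
    simp only [hΦ, opAt_val (closure_TM_subset_IB hφ)]

theorem continuousSection_rightContraction {y : ∀ t, E t} (hy : ContinuousSection n y) :
    ContinuousSection n fun t => rightContraction (fibreEquiv n E t) (opAt φ t) (y t) := by
  refine continuousSection_of_eventuallyEq fun t₀ => ?_
  obtain ⟨s, hs⟩ := exists_section_matrixUnit (n := n) (E := E) t₀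
  refine ⟨fun t => ∑ i, ∑ j, (s i j).val t * y t * (φ (s j i)).val t, ?_, ?_⟩
  · exact ContinuousSection.sum _ fun i => ContinuousSection.sum _ fun j =>
      ((s i j).continuousSection.mul n hy).mul n (φ (s j i)).continuousSection
  · filter_upwards [hs] with t ⟨Φ, hΦ⟩
    rw [rightContraction_congr _ Φ hφ, rightContraction]
    simp only [hΦ, opAt_val (closure_TM_subset_IB hφ)]

theorem mem_TM_of_le_norm_fibreOp (hn : 0 < n) {δ : ℝ} (hδ : 0 < δ)
    (h : ∀ t, δ ≤ ‖fibreOp φ (closure_TM_subset_IB hφ) t‖) : φ ∈ TM (Gamma0 n E) := by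
  have hn' : (0 : ℝ) < n := by exact_mod_cast hn
  set M := ‖φ‖ with hM
  have hM0 : 0 ≤ M := norm_nonneg φ
  -- With this `η` the error is at most half of the main term `δ ^ 2 / n ^ 4`, leaving `κ`. Using `M
  -- + 1` keeps the denominator positive even if `φ = 0`, which is possible when `X` is empty.
  set η : ℝ := δ ^ 2 / (2 * (n : ℝ) ^ 7 * (M + 1)) with hη
  have hη0 : 0 < η := by positivity
  set κ : ℝ := δ ^ 2 / (2 * (n : ℝ) ^ 4) with hκ
  have hκ0 : 0 < κ := by positivity
  have hκη : κ ≤ δ ^ 2 / (n : ℝ) ^ 4 - (n : ℝ) ^ 3 * (M * η) := by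
    have e1 : (n : ℝ) ^ 3 * ((M + 1) * η) = κ := by
      rw [hη, hκ]; field_simp
    have e2 : δ ^ 2 / (n : ℝ) ^ 4 = κ + κ := by
      rw [hκ]; field_simp; norm_num
    have e3 : (n : ℝ) ^ 3 * (M * η) ≤ (n : ℝ) ^ 3 * ((M + 1) * η) := by gcongr; linarith
    linarith
  -- A single approximant serves all `t`, so the coefficients built from it are global and need no
  -- patching.
  obtain ⟨_, ⟨c, d, rfl⟩, hd⟩ := Metric.mem_closure_iff.1 hφ η hη0
  rw [dist_eq_norm] at hd
  set y : ∀ t, E t := star (multiplierVal d) with hy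
  set z : ∀ t, E t := star (multiplierVal c) with hz
  have hyc : ContinuousSection n y := (continuousSection_multiplierVal d).star_section n
  have hzc : ContinuousSection n z := (continuousSection_multiplierVal c).star_section n
  have hyn : ∀ t, ‖y t‖ ≤ ‖d.fst‖ := fun t => by
    rw [hy, Pi.star_apply, norm_star]; exact norm_multiplierVal_le d t
  have hzn : ∀ t, ‖z t‖ ≤ ‖c.fst‖ := fun t => by
    rw [hz, Pi.star_apply, norm_star]; exact norm_multiplierVal_le c t
  set l : ∀ t, E t := fun t => leftContraction (fibreEquiv n E t) (opAt φ t) (y t) with hl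
  set r : ∀ t, E t := fun t => rightContraction (fibreEquiv n E t) (opAt φ t) (z t) with hr
  have hlc : ContinuousSection n l := continuousSection_leftContraction hφ hyc
  have hrc : ContinuousSection n r := continuousSection_rightContraction hφ hzc
  set lam : X → ℂ := fun t => fibreTrace (fibreEquiv n E t) (l t * z t) with hlam
  have hlamc : Continuous lam := (hlc.mul n hzc).continuous_fibreTrace
  have hlamκ : ∀ t, κ ≤ ‖lam t‖ := fun t => by
    exact hκη.trans ((re_fibreTrace_ge_of_close (closure_TM_subset_IB hφ) hn hδ.le (h t) hd.le).trans
      (Complex.re_le_norm _))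
  refine mem_TM_of_sections (closure_TM_subset_IB hφ) hlc hrc hlamc hκ0 hlamκ
    (Cl := (n : ℝ) ^ 2 * (M * ‖d.fst‖)) (Cr := (n : ℝ) ^ 2 * (M * ‖c.fst‖)) (fun t => ?_)
    (fun t => ?_) fun t x => leftContraction_mul_rightContraction (fibreEquiv n E t) hφ x _ _
  · refine (norm_leftContraction_le _ (norm_opAt_le φ t) hM0 _).trans ?_
    exact mul_le_mul_of_nonneg_left (mul_le_mul_of_nonneg_left (hyn t) hM0) (sq_nonneg _)
  · refine (norm_rightContraction_le _ (norm_opAt_le φ t) hM0 _).trans ?_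
    exact mul_le_mul_of_nonneg_left (mul_le_mul_of_nonneg_left (hzn t) hM0) (sq_nonneg _)

/-! ### The unital case: compactness and a uniform lower bound. -/

omit hφ

/-- The unit has norm one in every fibre, as `n > 0` makes the fibres nontrivial, yet its norm tends
to zero at infinity. -/
theorem compactSpace_of_isUnital (hn : 0 < n) {e : Gamma0 n E} (he : ∀ x, e * x = x ∧ x * e = x) :
    CompactSpace X := by
  have he1 : ∀ t, e.val t = 1 := fun t => by
    have h1 := congrArg (fun a => Gamma0.val a t) (he (lift t 1)).1
    simpa using h1
  have hnorm : ∀ t, ‖e.val t‖ = 1 := fun t => by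
    have := nontrivial_fibre (E := E) hn t
    rw [he1, CStarRing.norm_one]
  have h0 := e.tendsto_norm
  simp only [hnorm] at h0
  by_contra hne
  have : NoncompactSpace X := not_compactSpace_iff.1 hne
  exact one_ne_zero (tendsto_nhds_unique tendsto_const_nhds h0)

/-- A section `a` with `φ(a)(t₀) ≠ 0` bounds `‖φ_t‖` below near `t₀`, because `‖φ(a)(t)‖` is
continuous and `‖a(t)‖ ≤ ‖a‖`. Compactness leaves finitely many such bounds. -/
theorem exists_le_norm_fibreOp [CompactSpace X] {φ : Gamma0 n E →L[ℂ] Gamma0 n E}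
    (hφ : φ ∈ IB (Gamma0 n E)) (h : ∀ t, fibreOp φ hφ t ≠ 0) :
    ∃ δ > 0, ∀ t, δ ≤ ‖fibreOp φ hφ t‖ := by
  have hloc : ∀ t₀ : X, ∃ δ > 0, ∀ᶠ t in 𝓝 t₀, δ ≤ ‖fibreOp φ hφ t‖ := by
    intro t₀
    obtain ⟨v, hv⟩ : ∃ v, fibreOp φ hφ t₀ v ≠ 0 := by
      by_contra! hcon
      exact h t₀ (ContinuousLinearMap.ext hcon)
    set a : Gamma0 n E := lift t₀ v with ha
    have hpos : 0 < ‖(φ a).val t₀‖ := norm_pos_iff.2 hv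
    have ha0 : 0 < ‖a‖ + 1 := by positivity
    refine ⟨‖(φ a).val t₀‖ / 2 / (‖a‖ + 1), by positivity, ?_⟩
    filter_upwards [(φ a).continuousSection.continuous_norm.continuousAt.eventually
      (lt_mem_nhds (half_lt_self hpos))] with t ht
    rw [div_le_iff₀ ha0]
    calc ‖(φ a).val t₀‖ / 2 ≤ ‖(φ a).val t‖ := ht.le
      _ = ‖fibreOp φ hφ t (a.val t)‖ := by rw [fibreOp_val]
      _ ≤ ‖fibreOp φ hφ t‖ * ‖a.val t‖ := ContinuousLinearMap.le_opNorm _ _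
      _ ≤ ‖fibreOp φ hφ t‖ * (‖a‖ + 1) := by
        gcongr
        linarith [a.norm_val_le t]
  choose δ hδ0 hδ using hloc
  obtain ⟨S, hS⟩ := (isCompact_univ (X := X)).elim_nhds_subcover _ fun t _ => hδ t
  rcases S.eq_empty_or_nonempty with rfl | hne
  -- An empty subcover forces `X` to be empty, so any positive bound works.
  · exact ⟨1, one_pos, fun t => by simpa using hS.2 (Set.mem_univ t)⟩
  refine ⟨S.inf' hne δ, (Finset.lt_inf'_iff hne).2 fun i _ => hδ0 i, fun t => ?_⟩
  obtain ⟨i, hi, hit⟩ := Set.mem_iUnion₂.1 (hS.2 (Set.mem_univ t))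
  exact (Finset.inf'_le δ hi).trans hit

end Operators

end HomogCStar

end

theorem proposition6p4 (n : ℕ) (hn : 0 < n) {X : Type*} [TopologicalSpace X] [T2Space X]
    [LocallyCompactSpace X] (E : X → Type*) [∀ t, CStarAlgebra (E t)]
    [TopologicalSpace (Bundle.TotalSpace (Matrix (Fin n) (Fin n) ℂ) E)]
    [FiberBundle (Matrix (Fin n) (Fin n) ℂ) E] [HomogCStar.MatrixBundle n E] :
    (∀ (φ : HomogCStar.Gamma0 n E →L[ℂ] HomogCStar.Gamma0 n E)
        (hφ : φ ∈ closure (HomogCStar.TM (HomogCStar.Gamma0 n E))) (δ : ℝ), 0 < δ →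
        (∀ t : X, δ ≤ ‖HomogCStar.fibreOp φ (HomogCStar.closure_TM_subset_IB hφ) t‖) →
        φ ∈ HomogCStar.TM (HomogCStar.Gamma0 n E)) ∧
    ((∃ e : HomogCStar.Gamma0 n E, ∀ x, e * x = x ∧ x * e = x) →
      closure (HomogCStar.TM (HomogCStar.Gamma0 n E)) ∩ HomogCStar.IB1nv n E ⊆
        HomogCStar.TM (HomogCStar.Gamma0 n E)) := by
  refine ⟨fun φ hφ δ hδ h => HomogCStar.mem_TM_of_le_norm_fibreOp hφ hn hδ h, ?_⟩
  rintro ⟨e, he⟩ φ ⟨hφ, hφ', hne⟩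
  have := HomogCStar.compactSpace_of_isUnital hn he
  obtain ⟨δ, hδ, h⟩ := HomogCStar.exists_le_norm_fibreOp hφ' fun t => (hne t).1
  exact HomogCStar.mem_TM_of_le_norm_fibreOp hφ hn hδ h
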